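/- \textbf{Theorem (Inconsistent invariant variable selection for the Transfer Lasso).} Let $p$ be fixed, let $\beta^*\in\mathbb{R}^p$ have non-empty support $S=\{j:\beta^*_j\ne 0\}$, and let $\sigma>0$. For each $n$ let $y=X\beta^*+\varepsilon$, where $X\in\mathbb{R}^{n\times p}$ is a deterministic design with rows $x_1,\dots,x_n$ and the entries of $\varepsilon\in\mathbb{R}^n$ are i.i.d. $\mathcal{N}(0,\sigma^2)$. Suppose that $$\frac1n X^\top X\to C\succ O,\qquad \frac1n\max_i\|x_i\|_2^2\to 0\qquad(n\to\infty).$$ Let $m=m(n)$ be integers, positive for all large $n$, with $n/m\to r_0$ for some $r_0\in[0,\infty)$, and let $\tilde\beta$ be an initial estimator of $\beta^*$, independent of $\varepsilon$, such that $\sqrt m(\tilde\beta-\beta^*)$ converges in distribution to some random vector $z$ (so that $\tilde\beta$ is $\sqrt m$-consistent). Suppose that $\tilde\beta$ is inconsistent with respect to active variable selection, that is, $\limsup_{n\to\infty}P(\{j:\tilde\beta_j\neq0\}=S)\le c'<1$ for some constant $c'$. Let $\hat\beta_n^{\mathcal T}$ be a Transfer Lasso estimator, $$\hat\beta_n^{\mathcal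 T}\in\operatorname*{argmin}_\beta\Big\{\frac1n\|y-X\beta\|_2^2+\frac{\lambda_n}{n}\sum_j|\beta_j|+\frac{\eta_n}{n}\sum_j|\beta_j-\tilde\beta_j|\Big\},$$ where $\lambda_n/\sqrt n\to\lambda_0$ and $\eta_n/\sqrt n\to\eta_0$ for some $\lambda_0,\eta_0\in[0,\infty)$. Then the Transfer Lasso yields inconsistent invariant variable selection: there is a constant $c$ with $$\limsup_{n\to\infty}P\big(\hat\beta^{\mathcal T}_{n,S}=\tilde\beta_S\big)\le c<1,$$ where $v_S=(v_j)_{j\in S}$ is the restriction of $v$ to $S$. -/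

import Mathlib

open Filter Topology MeasureTheory ProbabilityTheory
open scoped ENNReal NNReal Matrix

/-- The Transfer Lasso objective
`(1/n) ‖y - X β‖₂² + (lam/n) ∑ⱼ |βⱼ| + (eta/n) ∑ⱼ |βⱼ - βinitⱼ|`. -/
noncomputable def transferLassoObjective {n p : ℕ} (X : Matrix (Fin n) (Fin p) ℝ)
    (y : Fin n → ℝ) (βinit : Fin p → ℝ) (lam eta : ℝ) (β : Fin p → ℝ) : ℝ :=
  1 / (n : ℝ) * ∑ i, (y i - (X *ᵥ β) i) ^ 2
    + lam / (n : ℝ) * ∑ j, |β j|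
    + eta / (n : ℝ) * ∑ j, |β j - βinit j|

/-- `βhat` is a Transfer Lasso estimate: a global minimizer of the Transfer Lasso objective. -/
def IsTransferLasso {n p : ℕ} (X : Matrix (Fin n) (Fin p) ℝ)
    (y : Fin n → ℝ) (βinit : Fin p → ℝ) (lam eta : ℝ) (βhat : Fin p → ℝ) : Prop :=
  IsMinOn (transferLassoObjective X y βinit lam eta) Set.univ βhat

/-- Inconsistent active variable selection of a sequence of estimators `b n` of `βstar`:
`limsup P(supp (b n) = supp βstar) ≤ c < 1` for some constant `c`. -/
def InconsistentActiveSelection {p : ℕ} {Ω : ℕ → Type*} [∀ n, MeasurableSpace (Ω n)]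
    (P : ∀ n, Measure (Ω n)) (b : ∀ n, Ω n → Fin p → ℝ) (βstar : Fin p → ℝ) : Prop :=
  ∃ c : ℝ≥0∞, c < 1 ∧
    limsup (fun n => P n {ω | {j | b n ω j ≠ 0} = {j | βstar j ≠ 0}}) atTop ≤ c

/-- Inconsistent invariant variable selection of a sequence of estimators `bhat n` of `βstar` with
initial estimators `binit n`: with `S = supp βstar`,
`limsup P((bhat n)_S = (binit n)_S) ≤ c < 1` for some constant `c`. -/
def InconsistentInvariantSelection {p : ℕ} {Ω : ℕ → Type*} [∀ n, MeasurableSpace (Ω n)]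
    (P : ∀ n, Measure (Ω n)) (bhat binit : ∀ n, Ω n → Fin p → ℝ) (βstar : Fin p → ℝ) : Prop :=
  ∃ c : ℝ≥0∞, c < 1 ∧
    limsup (fun n => P n {ω | ∀ j, βstar j ≠ 0 → bhat n ω j = binit n ω j}) atTop ≤ c

/-! One active coordinate `j` suffices. With penalties of order `√n`, minimality confines the
residual tested against `X w` to a band (`IsTransferLasso.abs_inner_residual_le`). For `w = n
(XᵀX)⁻¹ eⱼ` this test reads `(X w) ⬝ᵥ ε - n (βhatⱼ - βstarⱼ)`. On `βhatⱼ = βinitⱼ` it is a Gaussian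
minus an independent shift, and after standardization the band has bounded half-width. Wherever the
shift lies, a Gaussian tail escapes the band (`measure_abs_sub_le_le_of_indepFun`), so a fixed
amount of probability is lost. -/

theorem IsTransferLasso.abs_inner_residual_le {n p : ℕ} (hn : 0 < n)
    {X : Matrix (Fin n) (Fin p) ℝ} {y : Fin n → ℝ} {βinit : Fin p → ℝ} {lam eta : ℝ}
    {βhat : Fin p → ℝ} (h : IsTransferLasso X y βinit lam eta βhat) (w : Fin p → ℝ) :
    2 * |(X *ᵥ w) ⬝ᵥ (y - X *ᵥ βhat)| ≤ (|lam| + |eta|) * ∑ j, |w j| := by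
  set g := (X *ᵥ w) ⬝ᵥ (y - X *ᵥ βhat) with hg
  set q := (X *ᵥ w) ⬝ᵥ (X *ᵥ w) with hq
  set K := (|lam| + |eta|) * ∑ j, |w j| with hK
  have hn' : (0 : ℝ) < n := by exact_mod_cast hn
  have abs_sum (t : ℝ) (c : ℝ) (b : Fin p → ℝ) :
      c * (∑ j, |βhat j + t * w j - b j| - ∑ j, |βhat j - b j|)
        ≤ |c| * (|t| * ∑ j, |w j|) := by
    refine (le_abs_self _).trans ?_
    rw [abs_mul, ← Finset.sum_sub_distrib, Finset.mul_sum]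
    refine mul_le_mul_of_nonneg_left ((Finset.abs_sum_le_sum_abs _ _).trans
      (Finset.sum_le_sum fun j _ => ?_)) (abs_nonneg c)
    refine (abs_abs_sub_abs_le_abs_sub _ _).trans ?_
    rw [← abs_mul]
    exact le_of_eq (congrArg _ (by ring))
  -- Minimality against `βhat + t • w`: the loss is quadratic in `t`, while the penalties change by
  -- at most `K * |t|`.
  have key (t : ℝ) : 2 * (t * g) ≤ t ^ 2 * q + K * |t| := by
    have hmin := h (Set.mem_univ (βhat + t • w))
    simp only [Set.mem_ofPred_eq, transferLassoObjective] at hmin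
    have hsq : ∑ i, (y i - (X *ᵥ (βhat + t • w)) i) ^ 2
        = ∑ i, (y i - (X *ᵥ βhat) i) ^ 2 - 2 * (t * g) + t ^ 2 * q := by
      simp only [hg, hq, dotProduct, Finset.mul_sum, ← Finset.sum_sub_distrib,
        ← Finset.sum_add_distrib, Matrix.mulVec_add, Matrix.mulVec_smul, Pi.add_apply,
        Pi.sub_apply, Pi.smul_apply, smul_eq_mul]
      exact Finset.sum_congr rfl fun i _ => by ring
    have h1 := abs_sum t lam 0
    have h2 := abs_sum t eta βinit
    simp only [Pi.zero_apply, sub_zero] at h1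
    rw [hsq] at hmin
    simp only [Pi.add_apply, Pi.smul_apply, smul_eq_mul] at hmin
    have hmul := mul_le_mul_of_nonneg_left hmin hn'.le
    have hcancel (a b c d e : ℝ) :
        (n : ℝ) * (1 / n * a + b / n * c + d / n * e) = a + b * c + d * e := by
      field_simp
    rw [hcancel, hcancel] at hmul
    rw [hK]
    linarith
  have hlim (s : ℝ) (hs : |s| = 1) : 2 * (s * g) ≤ K := by
    have hs2 : s ^ 2 = 1 := by rw [← sq_abs, hs, one_pow]
    refine le_of_forall_pos_le_add fun δ hδ => ?_
    have hq0 : 0 ≤ q := by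
      rw [hq]; exact Finset.sum_nonneg fun i _ => mul_self_nonneg _
    -- This step size makes the quadratic term at most `δ` after division by it; the `+ 1` covers `q
    -- = 0`.
    have ht : 0 < δ / (q + 1) := by positivity
    have h1 := key (δ / (q + 1) * s)
    rw [abs_mul, hs, abs_of_pos ht, mul_pow, hs2] at h1
    have h2 : δ / (q + 1) * q ≤ δ := by
      rw [div_mul_eq_mul_div, div_le_iff₀ (by positivity)]
      nlinarith
    have h3 : δ / (q + 1) * (2 * (s * g)) ≤ δ / (q + 1) * (K + δ / (q + 1) * q) := by linarith
    linarith [le_of_mul_le_mul_left h3 ht]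
  rcases abs_cases g with ⟨hc, -⟩ | ⟨hc, -⟩ <;> rw [hc]
  · linarith [hlim 1 (by simp)]
  · linarith [hlim (-1) (by simp)]

theorem hasLaw_gaussianReal_sum_const_mul {Ω ι : Type*} [MeasurableSpace Ω] {P : Measure Ω}
    [IsProbabilityMeasure P] {ε : ι → Ω → ℝ} {v : ℝ≥0}
    (hlaw : ∀ i, HasLaw (ε i) (gaussianReal 0 v) P) (hindep : iIndepFun ε P)
    (a : ι → ℝ) (s : Finset ι) :
    HasLaw (∑ i ∈ s, fun ω => a i * ε i ω)
      (gaussianReal 0 (∑ i ∈ s, (NNReal.mk (a i ^ 2) (sq_nonneg _) * v))) P := by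
  classical
  have hY (i : ι) := gaussianReal_const_mul (hlaw i) (a i)
  have hind : iIndepFun (fun i ω => a i * ε i ω) P :=
    hindep.comp (fun i x => a i * x) fun i => measurable_const_mul _
  induction s using Finset.induction_on with
  | empty =>
    refine ⟨by simp; fun_prop, ?_⟩
    simp [Pi.zero_def, gaussianReal_zero_var]
  | insert i s hi ih =>
    rw [Finset.sum_insert hi, Finset.sum_insert hi]
    have hsum := (hind.indepFun_finsetSum_of_notMem₀ (fun j => (hY j).aemeasurable) hi).symm
    refine ⟨(hY i).aemeasurable.add ih.aemeasurable, ?_⟩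
    have := gaussianReal_add_gaussianReal_of_indepFun hsum (hY i).map_eq ih.map_eq
    simpa using this

theorem hasLaw_standardGaussian_dotProduct {Ω ι : Type*} [MeasurableSpace Ω] [Fintype ι]
    {P : Measure Ω} [IsProbabilityMeasure P] {ε : Ω → ι → ℝ} {v : ℝ≥0}
    (hlaw : ∀ i, HasLaw (fun ω => ε ω i) (gaussianReal 0 v) P)
    (hindep : iIndepFun (fun i ω => ε ω i) P) (a : ι → ℝ) (ha : (a ⬝ᵥ a) * v = 1) :
    HasLaw (fun ω => a ⬝ᵥ ε ω) (gaussianReal 0 1) P := by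
  have h := hasLaw_gaussianReal_sum_const_mul hlaw hindep a Finset.univ
  have hfun : (∑ i, fun ω => a i * ε ω i) = fun ω => a ⬝ᵥ ε ω := by
    ext ω
    simp [dotProduct]
  have hvar : ∑ i, NNReal.mk (a i ^ 2) (sq_nonneg _) * v = 1 := by
    rw [← NNReal.coe_inj, NNReal.coe_one, ← ha, dotProduct, Finset.sum_mul, NNReal.coe_sum]
    simp [sq]
  rwa [hfun, hvar] at h

/-- Splitting on the sign of `V` avoids conditioning on its value: in the band, `V ≤ 0` forces `T ≤
K` and `V > 0` forces `T ≥ -K`. By symmetry both half-lines have the same Gaussian mass, and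
independence factors it out. -/
theorem measure_abs_sub_le_le_of_indepFun {Ω E F : Type*} [MeasurableSpace Ω]
    [MeasurableSpace E] [MeasurableSpace F] {P : Measure Ω} [IsProbabilityMeasure P]
    {b : Ω → E} {e : Ω → F} (hb : AEMeasurable b P) (hind : IndepFun b e P)
    {V : E → ℝ} (hV : Measurable V) {T : F → ℝ} (hT : Measurable T)
    (hlaw : HasLaw (fun ω => T (e ω)) (gaussianReal 0 1) P) (K : ℝ) :
    P {ω | |T (e ω) - V (b ω)| ≤ K} ≤ gaussianReal 0 1 (Set.Iic K) := by
  have hA : MeasurableSet {x | V x ≤ 0} := measurableSet_le hV measurable_const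
  have hlow : P (e ⁻¹' (T ⁻¹' Set.Iic K)) = gaussianReal 0 1 (Set.Iic K) :=
    hlaw.measure_eq measurableSet_Iic
  have hneg : gaussianReal 0 1 (Set.Ici (-K)) = gaussianReal 0 1 (Set.Iic K) := by
    have h := gaussianReal_map_neg (μ := 0) (v := 1)
    rw [neg_zero] at h
    conv_lhs => rw [← h]
    rw [Measure.map_apply measurable_neg measurableSet_Ici]
    congr 1
    ext x
    simp
  have hup : P (e ⁻¹' (T ⁻¹' Set.Ici (-K))) = gaussianReal 0 1 (Set.Iic K) :=
    (hlaw.measure_eq measurableSet_Ici).trans hneg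
  calc P {ω | |T (e ω) - V (b ω)| ≤ K}
      ≤ P (b ⁻¹' {x | V x ≤ 0} ∩ e ⁻¹' (T ⁻¹' Set.Iic K)
          ∪ b ⁻¹' {x | V x ≤ 0}ᶜ ∩ e ⁻¹' (T ⁻¹' Set.Ici (-K))) := by
        refine measure_mono fun ω hω => ?_
        rw [Set.mem_ofPred_eq, abs_le] at hω
        obtain ⟨h1, h2⟩ := hω
        rcases le_or_gt (V (b ω)) 0 with hv | hv
        · exact Or.inl ⟨hv, by simp only [Set.mem_preimage, Set.mem_Iic]; linarith⟩
        · exact Or.inr ⟨not_le.2 hv, by simp only [Set.mem_preimage, Set.mem_Ici]; linarith⟩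
    _ ≤ _ := measure_union_le _ _
    _ = (P (b ⁻¹' {x | V x ≤ 0}) + P (b ⁻¹' {x | V x ≤ 0}ᶜ))
          * gaussianReal 0 1 (Set.Iic K) := by
        rw [hind.measure_inter_preimage_eq_mul _ _ hA (hT measurableSet_Iic),
          hind.measure_inter_preimage_eq_mul _ _ hA.compl (hT measurableSet_Ici),
          hlow, hup, add_mul]
    _ = gaussianReal 0 1 (Set.Iic K) := by
        have := Measure.isProbabilityMeasure_map hb
        rw [← Measure.map_apply_of_aemeasurable hb hA,
          ← Measure.map_apply_of_aemeasurable hb hA.compl, prob_add_prob_compl hA, one_mul]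

theorem gaussianReal_Iic_lt_one (K : ℝ) : gaussianReal 0 1 (Set.Iic K) < 1 := by
  refine lt_of_le_of_ne prob_le_one fun h => ?_
  have h0 : gaussianReal 0 1 (Set.Ioi K) = 0 := by
    rw [← Set.compl_Iic, prob_compl_eq_zero_iff measurableSet_Iic]
    exact h
  -- Lebesgue measure is absolutely continuous with respect to this Gaussian, so the half-line would
  -- be Lebesgue-null.
  have hv := gaussianReal_absolutelyContinuous' 0 one_ne_zero h0
  simp at hv

/-- If `XᵀX w = n eⱼ`, the stationarity inequality in the direction `w` confines the event
`βhatⱼ = βinitⱼ` to a noise band whose standardized half-width is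
`(|lam| + |eta|) ‖w‖₁ / (2 σ √(n wⱼ))`. -/
theorem IsTransferLasso.measure_eq_init_le {n p : ℕ} (hn : 0 < n) {Ω : Type*}
    [MeasurableSpace Ω] {P : Measure Ω} [IsProbabilityMeasure P]
    {X : Matrix (Fin n) (Fin p) ℝ} {βstar : Fin p → ℝ} {σ : ℝ≥0} (hσ : 0 < σ)
    {ε : Ω → Fin n → ℝ} (hεlaw : ∀ i, HasLaw (fun ω => ε ω i) (gaussianReal 0 (σ ^ 2)) P)
    (hεindep : iIndepFun (fun i ω => ε ω i) P)
    {βinit : Ω → Fin p → ℝ} (hβinit : AEMeasurable βinit P) (hindep : IndepFun βinit ε P)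
    {lam eta : ℝ} {βhat : Ω → Fin p → ℝ}
    (hβhat : ∀ ω, IsTransferLasso X (X *ᵥ βstar + ε ω) (βinit ω) lam eta (βhat ω))
    {w : Fin p → ℝ} {j : Fin p} (hw : (Xᵀ * X) *ᵥ w = (n : ℝ) • Pi.single j 1)
    (hwj : 0 < w j) :
    P {ω | βhat ω j = βinit ω j} ≤ gaussianReal 0 1
      (Set.Iic ((|lam| + |eta|) * (∑ j, |w j|) / (2 * (σ * √(n * w j))))) := by
  have hn' : (0 : ℝ) < n := by exact_mod_cast hn
  have hσ' : (0 : ℝ) < σ := by exact_mod_cast hσ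
  have hdot (u : Fin p → ℝ) : (X *ᵥ w) ⬝ᵥ (X *ᵥ u) = n * u j := by
    rw [Matrix.dotProduct_mulVec, Matrix.vecMul_mulVec, ← Matrix.mulVec_transpose,
      Matrix.transpose_mul, Matrix.transpose_transpose, hw, smul_dotProduct,
      single_one_dotProduct, smul_eq_mul]
  -- The standard deviation of `(X w) ⬝ᵥ ε`, since `hdot` at `u = w` gives `‖X w‖₂² = n wⱼ`.
  set s : ℝ := σ * √(n * w j) with hs
  have hs0 : 0 < s := by positivity
  have hs2 : s ^ 2 = σ ^ 2 * (n * w j) := by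
    rw [hs, mul_pow, Real.sq_sqrt (by positivity)]
  have hlaw : HasLaw (fun ω => (s⁻¹ • (X *ᵥ w)) ⬝ᵥ ε ω) (gaussianReal 0 1) P := by
    refine hasLaw_standardGaussian_dotProduct hεlaw hεindep _ ?_
    rw [smul_dotProduct, dotProduct_smul, hdot, smul_eq_mul, smul_eq_mul, NNReal.coe_pow]
    field_simp
    rw [hs2]
    ring
  refine (measure_mono fun ω hω => ?_).trans (measure_abs_sub_le_le_of_indepFun hβinit hindep
    (V := fun b => s⁻¹ * (n * (b j - βstar j))) (by fun_prop)
    (T := fun e => (s⁻¹ • (X *ᵥ w)) ⬝ᵥ e) (by unfold dotProduct; fun_prop) hlaw _)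
  have hk := (hβhat ω).abs_inner_residual_le hn w
  have hres : X *ᵥ βstar + ε ω - X *ᵥ βhat ω = ε ω - X *ᵥ (βhat ω - βstar) := by
    rw [Matrix.mulVec_sub]; abel
  -- On the event, `βhatⱼ` becomes `βinitⱼ`, so the shift depends only on the initial estimator and
  -- is independent of the noise.
  rw [hres, dotProduct_sub, hdot, Pi.sub_apply, (hω : βhat ω j = βinit ω j)] at hk
  simp only [Set.mem_ofPred_eq, smul_dotProduct, smul_eq_mul]
  rw [← mul_sub, abs_mul, abs_of_pos (inv_pos.2 hs0), le_div_iff₀ (by positivity)]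
  refine le_trans (le_of_eq ?_) hk
  field_simp

theorem mainTheorem9
    {p : ℕ}
    -- the true parameter, with at least one active variable, and the noise level
    (βstar : Fin p → ℝ) (hβstar : βstar ≠ 0)
    (σ : ℝ≥0) (hσ : 0 < σ)
    -- the probability spaces, one for each target sample size `n`
    {Ω : ℕ → Type*} [∀ n, MeasurableSpace (Ω n)]
    (P : ∀ n, Measure (Ω n)) [∀ n, IsProbabilityMeasure (P n)]
    -- the design: `(1/n) Xᵀ X → C ≻ 0` and `(1/n) maxᵢ ‖xᵢ‖₂² → 0`
    (X : ∀ n : ℕ, Matrix (Fin n) (Fin p) ℝ)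
    (C : Matrix (Fin p) (Fin p) ℝ) (hC : C.PosDef)
    (hXC : Tendsto (fun n : ℕ => (1 / (n : ℝ)) • ((X n)ᵀ * X n)) atTop (𝓝 C))
    (hXmax : Tendsto (fun n : ℕ => 1 / (n : ℝ) * ⨆ i : Fin n, ∑ j, X n i j ^ 2) atTop (𝓝 0))
    -- the i.i.d. Gaussian noise and the response of the linear model
    (ε : ∀ n : ℕ, Ω n → Fin n → ℝ)
    (hεlaw : ∀ (n : ℕ) (i : Fin n), HasLaw (fun ω => ε n ω i) (gaussianReal 0 (σ ^ 2)) (P n))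
    (hεindep : ∀ n : ℕ, iIndepFun (fun (i : Fin n) ω => ε n ω i) (P n))
    (y : ∀ n : ℕ, Ω n → Fin n → ℝ)
    (hy : ∀ (n : ℕ) (ω : Ω n), y n ω = X n *ᵥ βstar + ε n ω)
    -- the source sample sizes: `n / m → r₀ ≥ 0`
    (m : ℕ → ℕ) (hm : ∀ᶠ n in atTop, 0 < m n)
    (r₀ : ℝ) (hr₀ : 0 ≤ r₀)
    (hmr : Tendsto (fun n : ℕ => (n : ℝ) / (m n : ℝ)) atTop (𝓝 r₀))
    -- the initial estimator, independent of the target data,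
    -- with `√m (βinit - βstar)` convergent in distribution
    (βinit : ∀ n, Ω n → Fin p → ℝ)
    (hindep : ∀ n, IndepFun (βinit n) (ε n) (P n))
    {Ω' : Type*} [MeasurableSpace Ω'] (P' : Measure Ω') [IsProbabilityMeasure P']
    (z : Ω' → Fin p → ℝ)
    (hz : TendstoInDistribution
      (fun (n : ℕ) ω => √(m n : ℝ) • (βinit n ω - βstar)) atTop z P P')
    (hinit : InconsistentActiveSelection P βinit βstar)
    -- the hyperparameters: `lam n / √n → lam₀ ≥ 0` and `eta n / √n → eta₀ ≥ 0`
    (lam eta : ℕ → ℝ) (lam₀ eta₀ : ℝ) (hlam₀ : 0 ≤ lam₀) (heta₀ : 0 ≤ eta₀)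
    (hlam : Tendsto (fun n : ℕ => lam n / √(n : ℝ)) atTop (𝓝 lam₀))
    (heta : Tendsto (fun n : ℕ => eta n / √(n : ℝ)) atTop (𝓝 eta₀))
    -- the Transfer Lasso estimator
    (βhat : ∀ n, Ω n → Fin p → ℝ)
    (hβhat : ∀ (n : ℕ) (ω : Ω n),
      IsTransferLasso (X n) (y n ω) (βinit n ω) (lam n) (eta n) (βhat n ω)) :
    InconsistentInvariantSelection P βhat βinit βstar := by
  obtain ⟨j, hj⟩ : ∃ j, βstar j ≠ 0 := Function.ne_iff.1 hβstar
  set G : ℕ → Matrix (Fin p) (Fin p) ℝ := fun n => (1 / (n : ℝ)) • ((X n)ᵀ * X n) with hG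
  have hdet : C.det ≠ 0 := hC.det_pos.ne'
  have hinv : Tendsto (fun n => (G n)⁻¹) atTop (𝓝 C⁻¹) :=
    (continuousAt_matrix_inv C
      (by simpa using NormedRing.inverse_continuousAt (Units.mk0 _ hdet))).tendsto.comp hXC
  have hunit : ∀ᶠ n in atTop, IsUnit (G n).det := by
    filter_upwards [((continuous_id.matrix_det.tendsto C).comp hXC).eventually_ne hdet] with n h
    exact isUnit_iff_ne_zero.2 h
  have hentry (k : Fin p) : Tendsto (fun n => (G n)⁻¹ k j) atTop (𝓝 (C⁻¹ k j)) :=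
    tendsto_pi_nhds.1 (tendsto_pi_nhds.1 hinv k) j
  have hCj : 0 < C⁻¹ j j := hC.inv.diag_pos
  have hσ' : (0 : ℝ) < σ := by exact_mod_cast hσ
  -- The half-width of `IsTransferLasso.measure_eq_init_le` with `√n` moved under `lam n` and `eta
  -- n`, so that every factor converges.
  set K : ℕ → ℝ := fun n =>
    (|lam n / √n| + |eta n / √n|) * (∑ k, |(G n)⁻¹ k j|) / (2 * (σ * √((G n)⁻¹ j j))) with hK
  obtain ⟨L, hL⟩ : ∃ L, Tendsto K atTop (𝓝 L) :=
    ⟨_, ((hlam.abs.add heta.abs).mul (tendsto_finsetSum _ fun k _ => (hentry k).abs)).div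
      (((hentry j).sqrt.const_mul (σ : ℝ)).const_mul 2) (by positivity)⟩
  -- Since `K n → L`, eventually `K n < L + 1`, which makes the bound independent of `n`.
  refine ⟨gaussianReal 0 1 (Set.Iic (L + 1)), gaussianReal_Iic_lt_one _,
    limsup_le_of_le (h := ?_)⟩
  filter_upwards [hunit, (hentry j).eventually_const_lt hCj, eventually_gt_atTop 0, hm,
    hL.eventually_lt_const (lt_add_one L)] with n hu hpos hn hmn hKn
  have hn' : (0 : ℝ) < n := by exact_mod_cast hn
  have hsm : √(m n : ℝ) ≠ 0 := (Real.sqrt_pos.2 (by exact_mod_cast hmn)).ne'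
  -- Convergence in distribution carries measurability of the rescaled error; undoing the scaling
  -- needs `m n > 0`.
  have hbm : AEMeasurable (βinit n) (P n) := by
    refine (((hz.forall_aemeasurable n).const_smul (√(m n : ℝ))⁻¹).add_const βstar).congr
      (Eventually.of_forall fun ω => ?_)
    simp [smul_smul, inv_mul_cancel₀ hsm]
  -- The direction `w` is column `j` of `(G n)⁻¹`; its entry `wⱼ` is eventually positive because
  -- `C⁻¹ j j > 0`.
  have hw : ((X n)ᵀ * X n) *ᵥ (fun k => (G n)⁻¹ k j) = (n : ℝ) • Pi.single j 1 := by
    have h1 : (X n)ᵀ * X n = (n : ℝ) • G n := by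
      simp [hG, smul_smul, hn'.ne']
    have h2 : (fun k => (G n)⁻¹ k j) = (G n)⁻¹ *ᵥ Pi.single j 1 := by
      rw [Matrix.mulVec_single_one]; rfl
    rw [h1, h2, Matrix.smul_mulVec, Matrix.mulVec_mulVec, Matrix.mul_nonsing_inv _ hu,
      Matrix.one_mulVec]
  have hbound := IsTransferLasso.measure_eq_init_le hn hσ (hεlaw n) (hεindep n) hbm (hindep n)
    (fun ω => hy n ω ▸ hβhat n ω) hw hpos
  refine le_trans (measure_mono fun ω hω => ?_) (hbound.trans (measure_mono ?_))
  · rw [Set.mem_ofPred_eq] at hω ⊢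
    exact hω j hj
  refine Set.Iic_subset_Iic.2 (le_trans (le_of_eq ?_) hKn.le)
  have hsn : 0 < √(n : ℝ) := Real.sqrt_pos.2 hn'
  have hsw := Real.sqrt_pos.2 hpos
  simp only [hK]
  rw [Real.sqrt_mul hn'.le, abs_div, abs_div, abs_of_pos hsn]
  field_simp
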